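/- Let $P$ be a finite (possibly empty) set of prime numbers. Then there exist a finite group $G$ and two finite, transitive, non-isomorphic $G$-sets $X$ and $Y$ such that, for every field $k$, the permutation representations $k[X]$ and $k[Y]$ are isomorphic as modules over the group algebra $kG$ if and only if $\operatorname{char} k \notin P$. Moreover, if $P$ is non-empty, then $G$ can be chosen to be a direct product $\prod_{p\in P} G_p$ in which each $G_p$ is a $p$-group. Here $k[X]$ denotes the $k$-vector space of all maps $f\colon X\to k$ with $G$ acting by $(g f)(x)=f(g^{-1}x)$, a transitive $G$-set is one with exactly one orbit, and two $G$-sets are isomorphic if there is a $G$-equivariant bijection between them. -/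

import Mathlib

/-- The permutation representation `k[X]` of a group `G` on a `G`-set `X`: the `k`-module of all
maps `X → k`, on which `g` acts by `(g • f) x = f (g⁻¹ • x)`. -/
def permRep (k G X : Type*) [Field k] [Group G] [MulAction G X] : Representation k G (X → k) where
  toFun g := LinearMap.funLeft k k (fun x : X => g⁻¹ • x)
  map_one' := by
    ext f x
    simp [LinearMap.funLeft_apply]
  map_mul' g h := by
    ext f x
    simp [LinearMap.funLeft_apply, mul_smul]

/-- Linear equivalence over `k`: the modules `k[X]` and `k[Y]` over the group algebra `kG` are
isomorphic. -/
def LinearlyEquivalent (k G X Y : Type*) [Field k] [Group G] [MulAction G X] [MulAction G Y] :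
    Prop :=
  Nonempty ((permRep k G X).asModule ≃ₗ[MonoidAlgebra k G] (permRep k G Y).asModule)

/-- Isomorphism of `G`-sets: there is an equivariant bijection. -/
def GSetIsomorphic (G X Y : Type*) [Group G] [MulAction G X] [MulAction G Y] : Prop :=
  ∃ f : X ≃ Y, ∀ (g : G) (x : X), f (g • x) = g • f x

/-- A transitive `G`-set: it has exactly one orbit (in particular, it is not empty). -/
def IsTransitiveGSet (G X : Type*) [Group G] [MulAction G X] : Prop :=
  Nonempty X ∧ MulAction.IsPretransitive G X

/-- `G` is (isomorphic to) a direct product, over `p ∈ P`, of `p`-groups. -/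
def IsProductOfPGroups (G : Type) [Group G] (P : Finset ℕ) : Prop :=
  ∃ (S : P → Type) (_ : ∀ p, Group (S p)),
    (∀ p : P, IsPGroup (p : ℕ) (S p)) ∧ Nonempty (G ≃* ((p : P) → S p))

/-!
For each prime `p` there is a `p`-group with two transitive sets whose permutation modules are
isomorphic exactly away from characteristic `p`; a direct product of these examples settles the case
of non-empty `P`, and a wreath product built from the examples at `2` and `3` the case of empty `P`.

*The example at `p`.* Let `F = 𝔽_p` and let `U = F²` act on `V = F⁴` by the maps `shear a b`. The
group `V ⋊ U` (`ShearGroup F`) acts on `V` by affine maps, and this action can be twisted by a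
multiple `t` of the cocycle `(a, b) ↦ (a, 0)` of `U` in `V` (`TwistedSpace F t`). The cocycle is not
a coboundary, so different twists have non-conjugate point stabilizers
(`exists_twistedAction_ne`). However, the twisted and the untwisted action are intertwined by a
function on `V` that is built from a family of affine hyperplanes, one for each direction not
containing the first axis, which is invariant under the twisted action of `U`
(`hyperplaneKernel_shear`). That function is invertible under convolution as soon as `p` is
invertible, by counting the points on intersections of hyperplanes (`hyperplaneKernel_convolution`).

*Characteristic `p`.* If a `p`-group `Q` fixes a point of `X`, then `k[X]` has an invariant vector
and an invariant functional whose pairing is `1`. If `Q` has no fixed point on `Y`, the pairing of an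
invariant vector with an invariant functional on `k[Y]` is a sum over orbits of length divisible by
`p`, hence zero. Thus an isomorphism `k[X] ≅ k[Y]` forces `Q` to have a fixed point on `Y`
(`LinearlyEquivalent.exists_fixed_point`); for `Q` the stabilizer of a point in the factor at `p`
this fails.

*Every characteristic.* Let `Γ` be the product of the groups at `2` and `3`, and write `S i j` for
the product of the spaces with twist `i` at `2` and `j` at `3`. Consider the sets over the wreath
product `Γ ≀ C₂` induced from the `Γ × Γ`-sets `S 0 0 × S 1 1` and `S 1 0 × S 0 1`. Where `2` is
invertible, the twists at `2` can be changed in both factors of the first product, which yields the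
second one. Where `3` is invertible, the twists at `3` can be changed, which yields the second one
with its factors exchanged, and the induced set does not see the exchange. One of `2` and `3` is
invertible in each field. The induced sets are not isomorphic because `S 0 0` is isomorphic to
neither `S 1 0` nor `S 0 1`.
-/

/-! ### Intertwining matrices and fixed points of `p`-subgroups -/

section PermutationModules

variable {k G X Y : Type*} [Field k] [Group G] [MulAction G X] [MulAction G Y]

theorem permRep_apply (g : G) (f : X → k) (x : X) : permRep k G X g f x = f (g⁻¹ • x) := rfl

theorem LinearlyEquivalent.exists_linearEquiv (h : LinearlyEquivalent k G X Y) :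
    ∃ e : (X → k) ≃ₗ[k] (Y → k), ∀ g f, e (permRep k G X g f) = permRep k G Y g (e f) := by
  obtain ⟨e⟩ := h
  let F := (Representation.IntertwiningMap.equivLinearMapAsModule
    (permRep k G X) (permRep k G Y)).symm e.toLinearMap
  refine ⟨LinearEquiv.ofBijective F.toLinearMap e.bijective, fun g f ↦ ?_⟩
  exact LinearMap.congr_fun (F.isIntertwining' g) f

theorem LinearlyEquivalent.of_linearEquiv (e : (X → k) ≃ₗ[k] (Y → k))
    (he : ∀ g f, e (permRep k G X g f) = permRep k G Y g (e f)) : LinearlyEquivalent k G X Y :=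
  ⟨LinearEquiv.ofBijective (Representation.IntertwiningMap.equivLinearMapAsModule
    (permRep k G X) (permRep k G Y) ⟨e.toLinearMap, fun g ↦ LinearMap.ext (he g)⟩) e.bijective⟩

/-- If a finite `p`-group acts on a finite set without fixed points, then every invariant function
with values in a field of characteristic `p` sums to zero: each fibre of the function is a union of
orbits, all of length divisible by `p`. -/
theorem sum_eq_zero_of_no_fixed_point {Q : Type*} [Group Q] [MulAction Q Y] [Fintype Y] {p : ℕ}
    (hp : p.Prime) (hk : (p : k) = 0) (hQ : IsPGroup p Q)
    (hY : ∀ y : Y, ∃ g : Q, g • y ≠ y) (f : Y → k) (hf : ∀ (g : Q) y, f (g • y) = f y) :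
    ∑ y, f y = 0 := by
  classical
  have := Fact.mk hp
  have key : ∀ c : k, ((Finset.univ.filter fun y ↦ f y = c).card : k) = 0 := by
    intro c
    let S : SubMulAction Q Y := ⟨{y | f y = c}, fun g {y} hy ↦ (hf g y).trans hy⟩
    have hd : p ∣ Nat.card S := by
      by_contra hnd
      obtain ⟨y, hy⟩ := hQ.nonempty_fixed_point_of_prime_not_dvd_card S hnd
      obtain ⟨g, hg⟩ := hY y
      exact hg (congrArg Subtype.val (hy g))
    have hc : Nat.card S = (Finset.univ.filter fun y ↦ f y = c).card :=
      Nat.subtype_card _ (fun y ↦ by simp only [Finset.mem_filter_univ]; rfl)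
    obtain ⟨m, hm⟩ := hd
    rw [← hc, hm, Nat.cast_mul, hk, zero_mul]
  have h := Finset.sum_comp (s := (Finset.univ : Finset Y)) (fun c : k ↦ c) f
  rw [h]
  exact Finset.sum_eq_zero fun c _ ↦ by rw [nsmul_eq_mul, key c, zero_mul]

/-- In characteristic `p`, the permutation module detects whether a `p`-subgroup has a fixed point.
A fixed point `x₀` gives an invariant vector and an invariant functional on `k[X]` whose pairing
is `1`; if there were no fixed point in `Y`, the pairing of an invariant vector with an invariant
functional on `k[Y]` would be a sum over orbits of length divisible by `p`. -/
theorem LinearlyEquivalent.exists_fixed_point [Finite Y] (h : LinearlyEquivalent k G X Y)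
    {p : ℕ} (hp : p.Prime) (hk : (p : k) = 0) (Q : Subgroup G) (hQ : IsPGroup p Q)
    (x₀ : X) (hx₀ : ∀ g ∈ Q, g • x₀ = x₀) : ∃ y : Y, ∀ g ∈ Q, g • y = y := by
  classical
  have := Fintype.ofFinite Y
  obtain ⟨e, he⟩ := h.exists_linearEquiv
  have he' : ∀ g f, e.symm (permRep k G Y g f) = permRep k G X g (e.symm f) := fun g f ↦ by
    rw [LinearEquiv.symm_apply_eq, he, LinearEquiv.apply_symm_apply]
  by_contra! hY
  set v := e (Pi.single x₀ 1) with hv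
  have hsingle : ∀ (g : G) (y : Y),
      permRep k G Y g (Pi.single y 1) = Pi.single (g • y) (1 : k) := by
    intro g y
    ext z
    simp only [permRep_apply, Pi.single_apply, inv_smul_eq_iff]
  have hvinv : ∀ g ∈ Q, ∀ y, v (g • y) = v y := by
    intro g hg y
    have h1 : permRep k G X g⁻¹ (Pi.single x₀ 1) = Pi.single x₀ (1 : k) := by
      ext z
      simp only [permRep_apply, inv_inv, Pi.single_apply]
      congr 1
      rw [smul_eq_iff_eq_inv_smul, hx₀ _ (Q.inv_mem hg)]
    have h2 := he g⁻¹ (Pi.single x₀ 1)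
    rw [h1] at h2
    have h3 := congrFun h2 y
    rw [permRep_apply, inv_inv] at h3
    exact h3.symm
  have hlinv : ∀ g ∈ Q, ∀ y : Y,
      e.symm (Pi.single (g • y) 1) x₀ = e.symm (Pi.single y (1 : k)) x₀ := by
    intro g hg y
    rw [← hsingle, he', permRep_apply, hx₀ _ (Q.inv_mem hg)]
  have hsum := sum_eq_zero_of_no_fixed_point (k := k) (Q := Q) (Y := Y) hp hk hQ
    (fun y ↦ by obtain ⟨g, hg, hgy⟩ := hY y; exact ⟨⟨g, hg⟩, hgy⟩)
    (fun y ↦ v y * e.symm (Pi.single y 1) x₀)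
    (fun g y ↦ by
      have h1 := hvinv g g.2 y
      have h2 := hlinv g g.2 y
      simp only [Subgroup.smul_def]
      rw [h1, h2])
  have hexp : v = ∑ y, v y • Pi.single y (1 : k) := pi_eq_sum_univ' v
  have hone : e.symm v x₀ = 1 := by simp [hv]
  rw [hexp, map_sum, Finset.sum_apply] at hone
  simp only [map_smul, Pi.smul_apply, smul_eq_mul] at hone
  rw [hsum] at hone
  exact zero_ne_one hone

/-- `k[X]` and `k[Y]` are isomorphic through an invertible matrix that is constant on the orbits
of `G` on `Y × X`. For finite `X` and `Y` this is the matrix form of `LinearlyEquivalent`, in which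
products of `G`-sets become entrywise products of matrices. -/
def KernelEquivalent (k G X Y : Type*) [Field k] [Group G] [MulAction G X] [MulAction G Y]
    [Fintype X] [Fintype Y] [DecidableEq X] [DecidableEq Y] : Prop :=
  ∃ (M : Matrix Y X k) (N : Matrix X Y k),
    M * N = 1 ∧ N * M = 1 ∧ ∀ (g : G) y x, M (g • y) (g • x) = M y x

variable [Fintype X] [Fintype Y] [DecidableEq X] [DecidableEq Y]

theorem KernelEquivalent.linearlyEquivalent (h : KernelEquivalent k G X Y) :
    LinearlyEquivalent k G X Y := by
  obtain ⟨M, N, hMN, hNM, hM⟩ := h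
  refine .of_linearEquiv (Matrix.toLin'OfInv hNM hMN) fun g f ↦ ?_
  ext y
  simp only [Matrix.toLin'OfInv_apply, permRep_apply, Matrix.toLin'_apply, Matrix.mulVec,
    dotProduct]
  rw [← Equiv.sum_comp (MulAction.toPerm g)]
  refine Finset.sum_congr rfl fun x _ ↦ ?_
  rw [MulAction.toPerm_apply, inv_smul_smul, ← hM g (g⁻¹ • y) x, smul_inv_smul]

variable (k G X) in
theorem KernelEquivalent.refl : KernelEquivalent k G X X := by
  refine ⟨1, 1, one_mul _, one_mul _, fun g y x ↦ ?_⟩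
  simp [Matrix.one_apply]

end PermutationModules

/-- Entrywise products of intertwining matrices intertwine direct products. -/
theorem KernelEquivalent.pi {k ι : Type*} [Field k] [Fintype ι] [DecidableEq ι]
    {G X Y : ι → Type*} [∀ i, Group (G i)] [∀ i, MulAction (G i) (X i)]
    [∀ i, MulAction (G i) (Y i)] [∀ i, Fintype (X i)] [∀ i, Fintype (Y i)]
    [∀ i, DecidableEq (X i)] [∀ i, DecidableEq (Y i)]
    (h : ∀ i, KernelEquivalent k (G i) (X i) (Y i)) :
    KernelEquivalent k ((i : ι) → G i) ((i : ι) → X i) ((i : ι) → Y i) := by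
  choose M N hMN hNM hM using h
  refine ⟨.of fun y x ↦ ∏ i, M i (y i) (x i), .of fun x y ↦ ∏ i, N i (x i) (y i), ?_, ?_, ?_⟩
  · ext y y'
    simp only [Matrix.mul_apply, Matrix.of_apply, ← Finset.prod_mul_distrib]
    rw [← Fintype.piFinset_univ, ← Finset.prod_univ_sum (fun _ ↦ Finset.univ)
      (fun i x ↦ M i (y i) x * N i x (y' i))]
    simp only [← Matrix.mul_apply, hMN, Matrix.one_apply, Finset.prod_ite_zero, funext_iff]
    simp
  · ext x x'
    simp only [Matrix.mul_apply, Matrix.of_apply, ← Finset.prod_mul_distrib]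
    rw [← Fintype.piFinset_univ, ← Finset.prod_univ_sum (fun _ ↦ Finset.univ)
      (fun i y ↦ N i (x i) y * M i y (x' i))]
    simp only [← Matrix.mul_apply, hNM, Matrix.one_apply, Finset.prod_ite_zero, funext_iff]
    simp
  · intro g y x
    exact Finset.prod_congr rfl fun i _ ↦ hM i (g i) (y i) (x i)

/-! ### Convolution of hyperplane kernels -/

section HyperplaneKernel

theorem sum_sub_mul_sub {k F : Type*} [Field k] [Fintype F] (A B : F → k) (α β : k) :
    ∑ e, (A e - α) * (B e - β) =
      ∑ e, A e * B e - (∑ e, A e) * β - α * ∑ e, B e + Fintype.card F * (α * β) := by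
  simp only [sub_mul, mul_sub, Finset.sum_sub_distrib, Finset.sum_mul, Finset.mul_sum,
    Finset.sum_const, Finset.card_univ, nsmul_eq_mul]
  ring

variable {k F ι : Type*} [Field k] [Field F] [Fintype F] [DecidableEq F] [Fintype ι]
  [DecidableEq ι]

/-- The number of solutions `w` of the affine equation `χ ⬝ᵥ w + s = 0`, as an element of `k`. -/
theorem sum_hyperplane_indicator (hk : (Fintype.card F : k) ≠ 0) (χ : ι → F) (s : F) :
    (∑ w : ι → F, if χ ⬝ᵥ w + s = 0 then (1 : k) else 0) =
      if χ = 0 then (if s = 0 then (Fintype.card (ι → F) : k) else 0)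
      else (Fintype.card (ι → F) : k) / Fintype.card F := by
  split_ifs with hχ hs
  · simp [hχ, hs]
  · simp [hχ, hs]
  · obtain ⟨i, hi⟩ := Function.ne_iff.mp hχ
    have hshift : ∀ s' : F, (∑ w : ι → F, if χ ⬝ᵥ w + s' = 0 then (1 : k) else 0) =
        ∑ w : ι → F, if χ ⬝ᵥ w + s = 0 then (1 : k) else 0 := by
      intro s'
      rw [← Equiv.sum_comp (Equiv.addRight (Pi.single i ((χ i)⁻¹ * (s - s'))))]
      refine Finset.sum_congr rfl fun w _ ↦ ?_
      congr 2
      rw [Equiv.coe_addRight, dotProduct_add, dotProduct_single, mul_inv_cancel_left₀ hi]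
      ring
    have htotal : (∑ s' : F, ∑ w : ι → F, if χ ⬝ᵥ w + s' = 0 then (1 : k) else 0) =
        Fintype.card (ι → F) := by
      rw [Finset.sum_comm]
      simp [add_eq_zero_iff_neg_eq]
    rw [eq_div_iff hk, ← htotal, Finset.sum_congr rfl fun s' _ ↦ hshift s', Finset.sum_const,
      Finset.card_univ, nsmul_eq_mul, mul_comm]

variable (k) in
/-- The function on `F × F^ι` that counts the hyperplanes `e + χ ⬝ᵥ w + Q χ = 0` through `(e, w)`,
one for each `χ`, with a correction off the line `w = 0` by the average number of those
hyperplanes. -/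
def hyperplaneKernel (Q : (ι → F) → F) (x : F × (ι → F)) : k :=
  (∑ χ : ι → F, if x.1 + χ ⬝ᵥ x.2 + Q χ = 0 then 1 else 0) -
    (Fintype.card (ι → F) : k) / Fintype.card F * (if x.2 = 0 then 0 else 1)

theorem hyperplaneKernel_mk (Q : (ι → F) → F) (e : F) (w : ι → F) :
    hyperplaneKernel k Q (e, w) = (∑ χ : ι → F, if e + χ ⬝ᵥ w + Q χ = 0 then 1 else 0) -
      (Fintype.card (ι → F) : k) / Fintype.card F * (if w = 0 then 0 else 1) := rfl

/-- The hyperplanes `e + χ ⬝ᵥ w + Q χ = 0` meet each line parallel to the first axis in exactly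
one point. -/
theorem sum_sum_hyperplane_indicator (Q : (ι → F) → F) (w : ι → F) :
    (∑ e : F, ∑ χ : ι → F, if e + χ ⬝ᵥ w + Q χ = 0 then (1 : k) else 0) =
      Fintype.card (ι → F) := by
  rw [Finset.sum_comm]
  simp only [add_assoc, add_eq_zero_iff_eq_neg, Finset.sum_ite_eq', Finset.mem_univ, if_true,
    Finset.sum_const, Finset.card_univ, nsmul_eq_mul, mul_one]

theorem sum_hyperplane_mul_hyperplane (Q : (ι → F) → F) (e : F) (w w₁ : ι → F) :
    (∑ e₁ : F,
      (∑ χ : ι → F, if e - e₁ + χ ⬝ᵥ (w - w₁) + Q χ = 0 then (1 : k) else 0) *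
      (∑ χ : ι → F, if e₁ + χ ⬝ᵥ w₁ + (-Q) χ = 0 then (1 : k) else 0)) =
      ∑ χ : ι → F, ∑ χ' : ι → F,
        if (χ' - χ) ⬝ᵥ w₁ + (e + χ ⬝ᵥ w + Q χ - Q χ') = 0 then (1 : k) else 0 := by
  simp only [Finset.sum_mul_sum]
  rw [Finset.sum_comm]
  refine Finset.sum_congr rfl fun χ _ ↦ ?_
  rw [Finset.sum_comm]
  refine Finset.sum_congr rfl fun χ' _ ↦ ?_
  have : ∀ (e₁ : F), e - e₁ + χ ⬝ᵥ (w - w₁) + Q χ = 0 ↔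
      e + χ ⬝ᵥ (w - w₁) + Q χ = e₁ := fun e₁ ↦ by
    rw [← sub_eq_zero (b := e₁)]; ring_nf
  simp only [this, ite_mul, one_mul, zero_mul, Finset.sum_ite_eq, Finset.mem_univ, if_true]
  congr 2
  rw [dotProduct_sub, sub_dotProduct, Pi.neg_apply]
  ring

/-- The convolution of the two kernels, summed over the line of points with second coordinate
`w₁`. -/
theorem sum_hyperplaneKernel_mul_line (hk : (Fintype.card F : k) ≠ 0) (Q : (ι → F) → F) (e : F)
    (w w₁ : ι → F) {N c : k} (hN : N = Fintype.card (ι → F)) (hc : c = N / Fintype.card F) :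
    (∑ e₁ : F, hyperplaneKernel k Q ((e, w) - (e₁, w₁)) * hyperplaneKernel k (-Q) (e₁, w₁)) =
      (∑ χ : ι → F, ∑ χ' : ι → F,
        if (χ' - χ) ⬝ᵥ w₁ + (e + χ ⬝ᵥ w + Q χ - Q χ') = 0 then (1 : k) else 0) -
      c * N + if w₁ = 0 then c * N * (if w = 0 then 1 else 0) else 0 := by
  have hcq : c * Fintype.card F = N := by rw [hc, div_mul_cancel₀ _ hk]
  have hA : (∑ e₁ : F, ∑ χ : ι → F,
      if e - e₁ + χ ⬝ᵥ (w - w₁) + Q χ = 0 then (1 : k) else 0) = N := by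
    rw [hN, ← sum_sum_hyperplane_indicator Q (w - w₁)]
    exact Equiv.sum_comp (Equiv.subLeft e)
      (fun e' ↦ ∑ χ : ι → F, if e' + χ ⬝ᵥ (w - w₁) + Q χ = 0 then (1 : k) else 0)
  simp only [Prod.mk_sub_mk, hyperplaneKernel_mk]
  rw [sum_sub_mul_sub, sum_hyperplane_mul_hyperplane, hA, sum_sum_hyperplane_indicator, ← hN,
    ← hc]
  simp only [sub_eq_zero (a := w)]
  generalize (∑ χ : ι → F, ∑ χ' : ι → F,
        if (χ' - χ) ⬝ᵥ w₁ + (e + χ ⬝ᵥ w + Q χ - Q χ') = 0 then (1 : k) else 0) = S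
  by_cases h1 : w₁ = 0
  · by_cases h2 : w = 0
    · simp only [h1, h2, if_true]; ring
    · simp only [h1, h2, if_true, if_false]; ring
  · by_cases h2 : w = w₁
    · simp only [h1, h2, if_true, if_false]; ring
    · simp only [h1, h2, if_false]; linear_combination c * hcq

theorem sum_sum_hyperplane_mul_hyperplane (hk : (Fintype.card F : k) ≠ 0) (Q : (ι → F) → F)
    (e : F) (w χ : ι → F) {N c : k} (hN : N = Fintype.card (ι → F))
    (hc : c = N / Fintype.card F) :
    (∑ w₁ : ι → F, ∑ χ' : ι → F,
        if (χ' - χ) ⬝ᵥ w₁ + (e + χ ⬝ᵥ w + Q χ - Q χ') = 0 then (1 : k) else 0) =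
      N * (if w ⬝ᵥ χ + e = 0 then 1 else 0) + N * c - c := by
  have hterm : ∀ χ' : ι → F, (∑ w₁ : ι → F,
      if (χ' - χ) ⬝ᵥ w₁ + (e + χ ⬝ᵥ w + Q χ - Q χ') = 0 then (1 : k) else 0) =
      c + if χ' = χ then N * (if w ⬝ᵥ χ + e = 0 then 1 else 0) - c else 0 := by
    intro χ'
    rw [sum_hyperplane_indicator hk, ← hN, ← hc]
    by_cases h : χ' = χ
    · rw [if_pos (sub_eq_zero.mpr h), if_pos h, h, add_sub_cancel_right,
        dotProduct_comm χ w, add_comm e]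
      split_ifs <;> ring
    · rw [if_neg (sub_ne_zero.mpr h), if_neg h, add_zero]
  rw [Finset.sum_comm, Finset.sum_congr rfl fun χ' _ ↦ hterm χ', Finset.sum_add_distrib,
    Finset.sum_ite_eq', if_pos (Finset.mem_univ χ), Finset.sum_const, Finset.card_univ,
    nsmul_eq_mul, ← hN]
  ring

/-- The kernels of opposite sections are inverse to each other up to a power of the order of `F`:
distinct hyperplanes of the family meet in the same number of points, and the correction term
cancels their contribution. -/
theorem hyperplaneKernel_convolution_zero (hk : (Fintype.card F : k) ≠ 0) (Q : (ι → F) → F)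
    (x : F × (ι → F)) :
    ∑ y, hyperplaneKernel k Q (x - y) * hyperplaneKernel k (-Q) y =
      if x = 0 then (Fintype.card (ι → F) : k) ^ 2 else 0 := by
  obtain ⟨e, w⟩ := x
  obtain ⟨N, hN⟩ : ∃ N : k, N = Fintype.card (ι → F) := ⟨_, rfl⟩
  obtain ⟨c, hc⟩ : ∃ c : k, c = N / Fintype.card F := ⟨_, rfl⟩
  rw [Fintype.sum_prod_type_right,
    Finset.sum_congr rfl fun w₁ _ ↦ sum_hyperplaneKernel_mul_line hk Q e w w₁ hN hc,
    Finset.sum_add_distrib, Finset.sum_sub_distrib, Finset.sum_comm,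
    Finset.sum_congr rfl fun χ _ ↦ sum_sum_hyperplane_mul_hyperplane hk Q e w χ hN hc,
    Finset.sum_sub_distrib, Finset.sum_add_distrib, ← Finset.mul_sum, sum_hyperplane_indicator hk,
    Finset.sum_ite_eq', if_pos (Finset.mem_univ _)]
  simp only [Finset.sum_const, Finset.card_univ, nsmul_eq_mul, ← hN, ← hc, Prod.mk_eq_zero]
  by_cases h1 : w = 0
  · by_cases h2 : e = 0
    · simp only [h1, h2, if_true, and_self]; ring
    · simp only [h1, h2, if_true, if_false, false_and]; ring
  · simp only [h1, if_false, and_false]; ring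

theorem hyperplaneKernel_convolution (hk : (Fintype.card F : k) ≠ 0) (Q : (ι → F) → F)
    (x z : F × (ι → F)) :
    ∑ y, hyperplaneKernel k Q (x - y) * hyperplaneKernel k (-Q) (y - z) =
      if x = z then (Fintype.card (ι → F) : k) ^ 2 else 0 := by
  rw [← Equiv.sum_comp (Equiv.addRight z)]
  simp only [Equiv.coe_addRight, add_sub_cancel_right, ← sub_sub, sub_right_comm x _ z]
  rw [hyperplaneKernel_convolution_zero hk]
  simp only [sub_eq_zero]

end HyperplaneKernel

/-! ### Shears of affine space and twisted actions -/

section ShearGroup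

variable {F : Type*} [CommRing F]

/-- The commuting unipotent maps `(e, f, g, h) ↦ (e + a g + b h, f - b g, g, h)` of `F⁴`. -/
def shear (a b : F) (x : F × (Fin 3 → F)) : F × (Fin 3 → F) :=
  (x.1 + a * x.2 1 + b * x.2 2, ![x.2 0 - b * x.2 1, x.2 1, x.2 2])

theorem shear_zero (x : F × (Fin 3 → F)) : shear 0 0 x = x := by
  refine Prod.ext (by simp [shear]) (funext fun i ↦ ?_)
  fin_cases i <;> simp [shear]

theorem shear_shear (a b a' b' : F) (x : F × (Fin 3 → F)) :
    shear a b (shear a' b' x) = shear (a + a') (b + b') x := by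
  refine Prod.ext (by simp [shear]; ring) (funext fun i ↦ ?_)
  fin_cases i <;> simp [shear]; ring

theorem shear_add (a b : F) (x y : F × (Fin 3 → F)) :
    shear a b (x + y) = shear a b x + shear a b y := by
  refine Prod.ext (by simp [shear]; ring) (funext fun i ↦ ?_)
  fin_cases i <;> simp [shear]; ring

theorem shear_map_sub (a b : F) (x y : F × (Fin 3 → F)) :
    shear a b (x - y) = shear a b x - shear a b y := by
  rw [eq_sub_iff_add_eq, ← shear_add, sub_add_cancel]

theorem shear_fst (a b s : F) : shear a b (s, 0) = (s, 0) := by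
  refine Prod.ext (by simp [shear]) (funext fun i ↦ ?_)
  fin_cases i <;> simp [shear]

variable (F) in
/-- The group of affine maps `x ↦ shear a b x + v` of `F⁴`. -/
@[ext]
structure ShearGroup where
  /-- The first parameter of the linear part. -/
  a : F
  /-- The second parameter of the linear part. -/
  b : F
  /-- The translation part. -/
  v : F × (Fin 3 → F)

namespace ShearGroup

instance : Mul (ShearGroup F) := ⟨fun g h ↦ ⟨g.a + h.a, g.b + h.b, g.v + shear g.a g.b h.v⟩⟩
instance : One (ShearGroup F) := ⟨⟨0, 0, 0⟩⟩
instance : Inv (ShearGroup F) := ⟨fun g ↦ ⟨-g.a, -g.b, -shear (-g.a) (-g.b) g.v⟩⟩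

theorem mul_def (g h : ShearGroup F) :
    g * h = ⟨g.a + h.a, g.b + h.b, g.v + shear g.a g.b h.v⟩ := rfl
theorem one_def : (1 : ShearGroup F) = ⟨0, 0, 0⟩ := rfl
theorem inv_def (g : ShearGroup F) : g⁻¹ = ⟨-g.a, -g.b, -shear (-g.a) (-g.b) g.v⟩ := rfl

instance : Group (ShearGroup F) := Group.ofLeftAxioms
  (fun g h l ↦ by simp only [mul_def, shear_add, shear_shear, add_assoc])
  (fun g ↦ by simp only [mul_def, one_def, shear_zero, zero_add])
  (fun g ↦ by simp only [mul_def, one_def, inv_def, neg_add_cancel])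

/-- The underlying set of the group is `F × F × F⁴`. -/
def equivProd : ShearGroup F ≃ F × F × F × (Fin 3 → F) where
  toFun g := (g.a, g.b, g.v)
  invFun x := ⟨x.1, x.2.1, x.2.2⟩

instance [Finite F] : Finite (ShearGroup F) := .of_equiv _ equivProd.symm

theorem isPGroup (p : ℕ) [NeZero p] : IsPGroup p (ShearGroup (ZMod p)) := by
  refine .of_card (n := 6) ?_
  rw [Nat.card_congr equivProd]
  simp only [Nat.card_prod, Nat.card_fun, Nat.card_zmod, Nat.card_fin]
  ring

end ShearGroup

/-- The action of `(a, b, v)` on `F⁴` by `x ↦ shear a b x + v + (t a, 0)`. The parameter `t` twists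
the inclusion of the linear parts by a cocycle. -/
def twistedAction (t : F) (g : ShearGroup F) (x : F × (Fin 3 → F)) : F × (Fin 3 → F) :=
  shear g.a g.b x + g.v + (t * g.a, 0)

theorem twistedAction_one (t : F) (x : F × (Fin 3 → F)) : twistedAction t 1 x = x := by
  simp only [twistedAction, ShearGroup.one_def, shear_zero, mul_zero, Prod.mk_zero_zero, add_zero]

theorem twistedAction_mul (t : F) (g h : ShearGroup F) (x : F × (Fin 3 → F)) :
    twistedAction t (g * h) x = twistedAction t g (twistedAction t h x) := by
  simp only [twistedAction, ShearGroup.mul_def, shear_add, shear_shear, shear_fst]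
  rw [mul_add, ← zero_add (0 : Fin 3 → F), ← Prod.mk_add_mk, zero_add]
  abel

/-- Point stabilizers in spaces with different twists are not conjugate. If the stabilizer of `x`
fixed `y`, then the difference `(e, f, g, h) = y - x` would satisfy `a g + b h + a (t' - t) = 0` and
`b g = 0` for all `a` and `b`. -/
theorem exists_twistedAction_ne {t t' : F} (ht : t ≠ t') (x y : F × (Fin 3 → F)) :
    ∃ g : ShearGroup F, twistedAction t g x = x ∧ twistedAction t' g y ≠ y := by
  let s : F → F → ShearGroup F := fun a b ↦ ⟨a, b, x - shear a b x - (t * a, 0)⟩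
  have hs : ∀ a b, twistedAction t (s a b) x = x := fun a b ↦ by
    simp only [twistedAction, s]
    abel
  by_contra! h
  have h1 := congrArg Prod.fst (h _ (hs 1 0))
  have h2 := congrFun (congrArg Prod.snd (h _ (hs 0 1))) 0
  simp only [twistedAction, shear, s, Prod.fst_add, Prod.snd_add, Prod.fst_sub, Prod.snd_sub,
    Pi.add_apply, Pi.sub_apply, Pi.zero_apply, Matrix.cons_val_zero] at h1 h2
  exact ht (by linear_combination -h1 - h2)

/-- The affine space `F⁴` with the action `twistedAction t` of `ShearGroup F`. -/
def TwistedSpace (F : Type*) (_t : F) : Type _ := F × (Fin 3 → F)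

namespace TwistedSpace

variable {t : F}

instance [Fintype F] : Fintype (TwistedSpace F t) := inferInstanceAs (Fintype (F × (Fin 3 → F)))
instance [DecidableEq F] : DecidableEq (TwistedSpace F t) :=
  inferInstanceAs (DecidableEq (F × (Fin 3 → F)))
instance : Inhabited (TwistedSpace F t) := ⟨(0 : F × (Fin 3 → F))⟩

instance : MulAction (ShearGroup F) (TwistedSpace F t) where
  smul := twistedAction t
  one_smul := twistedAction_one t
  mul_smul := twistedAction_mul t

instance : MulAction.IsPretransitive (ShearGroup F) (TwistedSpace F t) where
  exists_smul_eq (x y : F × (Fin 3 → F)) := ⟨⟨0, 0, y - x⟩, by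
    change twistedAction t _ x = y
    simp only [twistedAction, shear_zero, mul_zero, Prod.mk_zero_zero, add_zero, add_sub_cancel]⟩

theorem exists_smul_ne {t t' : F} (ht : t ≠ t') (x : TwistedSpace F t) (y : TwistedSpace F t') :
    ∃ g : ShearGroup F, g • x = x ∧ g • y ≠ y :=
  exists_twistedAction_ne ht x y

end TwistedSpace

end ShearGroup

/-! ### Twisted spaces away from the characteristic -/

section ShearKernel

variable {k F : Type*} [Field k] [Field F] [Fintype F] [DecidableEq F]

/-- The section `χ ↦ c (χ₁ + χ₀ χ₂)` defines a family of hyperplanes that is permuted by the shears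
combined with the cocycle `(a, b) ↦ (c a, 0)`. -/
theorem hyperplaneKernel_shear (c a b : F) (x : F × (Fin 3 → F)) :
    hyperplaneKernel k (fun χ ↦ c * (χ 1 + χ 0 * χ 2)) (shear a b x + (c * a, 0)) =
      hyperplaneKernel k (fun χ ↦ c * (χ 1 + χ 0 * χ 2)) x := by
  obtain ⟨e, w⟩ := x
  let σ : (Fin 3 → F) ≃ (Fin 3 → F) :=
    { toFun χ := ![χ 0, χ 1 + a - b * χ 0, χ 2 + b]
      invFun χ := ![χ 0, χ 1 - a + b * χ 0, χ 2 - b]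
      left_inv χ := by ext i; fin_cases i <;> simp; ring
      right_inv χ := by ext i; fin_cases i <;> simp; ring }
  have hw : (shear a b (e, w) + (c * a, 0)).2 = 0 ↔ w = 0 := by
    simp only [shear, Prod.snd_add, add_zero, funext_iff, Fin.forall_fin_succ]
    simp
    grind
  simp only [hyperplaneKernel, hw]
  congr 1
  symm
  rw [← Equiv.sum_comp σ]
  refine Finset.sum_congr rfl fun χ _ ↦ ?_
  congr 2
  simp [shear, σ, dotProduct, Fin.sum_univ_three]
  ring

/-- Away from the characteristic of `F`, all twists have isomorphic permutation modules. -/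
theorem TwistedSpace.kernelEquivalent (hk : (Fintype.card F : k) ≠ 0) (t t' : F) :
    KernelEquivalent k (ShearGroup F) (TwistedSpace F t) (TwistedSpace F t') := by
  set Q : (Fin 3 → F) → F := fun χ ↦ (t' - t) * (χ 1 + χ 0 * χ 2) with hQ
  set N : k := (Fintype.card (Fin 3 → F) : k) with hN
  have hN0 : N ^ 2 ≠ 0 := by simp [hN, hk]
  have hinv : ∀ (Q : (Fin 3 → F) → F) (x z : F × (Fin 3 → F)),
      (∑ y, hyperplaneKernel k Q (x - y) * ((N ^ 2)⁻¹ * hyperplaneKernel k (-Q) (y - z))) =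
        if x = z then 1 else 0 := fun Q x z ↦ by
    simp only [mul_left_comm _ (N ^ 2)⁻¹, ← Finset.mul_sum]
    rw [hyperplaneKernel_convolution hk, mul_ite, mul_zero, inv_mul_cancel₀ hN0]
  refine ⟨.of fun (y x : F × (Fin 3 → F)) ↦ hyperplaneKernel k Q (y - x),
    .of fun (x y : F × (Fin 3 → F)) ↦ (N ^ 2)⁻¹ * hyperplaneKernel k (-Q) (x - y), ?_, ?_, ?_⟩
  · ext y z
    exact (hinv Q y z).trans (Matrix.one_apply (i := y) (j := z)).symm
  · ext x z
    refine Eq.trans (Finset.sum_congr rfl fun y _ ↦ ?_)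
      ((hinv (-Q) x z).trans (Matrix.one_apply (i := x) (j := z)).symm)
    rw [neg_neg]
    exact (mul_assoc _ _ _).trans (mul_left_comm _ _ _)
  · intro g (y : F × (Fin 3 → F)) (x : F × (Fin 3 → F))
    change hyperplaneKernel k Q (twistedAction t' g y - twistedAction t g x) =
      hyperplaneKernel k Q (y - x)
    rw [hQ, ← hyperplaneKernel_shear (t' - t) g.a g.b (y - x), shear_map_sub, sub_mul,
      ← sub_self (0 : Fin 3 → F), ← Prod.mk_sub_mk]
    congr 1
    simp only [twistedAction]
    abel

end ShearKernel

/-! ### Products of twisted spaces over several primes -/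

section ShearProduct

theorem isPretransitive_pi {ι : Type*} {G X : ι → Type*} [∀ i, Group (G i)]
    [∀ i, MulAction (G i) (X i)] [∀ i, MulAction.IsPretransitive (G i) (X i)] :
    MulAction.IsPretransitive ((i : ι) → G i) ((i : ι) → X i) where
  exists_smul_eq x y := by
    choose g hg using fun i ↦ MulAction.exists_smul_eq (G i) (x i) (y i)
    exact ⟨g, funext hg⟩

theorem isTransitiveGSet_twistedProduct {P : Finset ℕ} (t : (p : P) → ZMod p) :
    IsTransitiveGSet ((p : P) → ShearGroup (ZMod p)) ((p : P) → TwistedSpace (ZMod p) (t p)) :=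
  ⟨⟨fun _ ↦ default⟩, isPretransitive_pi⟩

variable {P : Finset ℕ} [∀ p : P, Fact (p : ℕ).Prime] {t t' : (p : P) → ZMod p}

theorem kernelEquivalent_twistedProduct {k : Type*} [Field k]
    (h : ∀ p : P, t p ≠ t' p → ((p : ℕ) : k) ≠ 0) :
    KernelEquivalent k ((p : P) → ShearGroup (ZMod p)) ((p : P) → TwistedSpace (ZMod p) (t p))
      ((p : P) → TwistedSpace (ZMod p) (t' p)) := by
  refine .pi fun p ↦ ?_
  by_cases hp : t p = t' p
  · rw [hp]
    exact .refl _ _ _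
  · exact TwistedSpace.kernelEquivalent (by rw [ZMod.card]; exact h p hp) _ _

/-- The stabilizer of `x p` in the factor at `p` is a `p`-group that fixes `x` and has no fixed
point in a product with a different twist at `p`. -/
theorem exists_pSubgroup_twistedProduct (p : P) (hp : t p ≠ t' p)
    (x : (p : P) → TwistedSpace (ZMod p) (t p)) :
    ∃ Q : Subgroup ((p : P) → ShearGroup (ZMod p)), IsPGroup p Q ∧ (∀ g ∈ Q, g • x = x) ∧
      ∀ y : (p : P) → TwistedSpace (ZMod p) (t' p), ∃ g ∈ Q, g • y ≠ y := by
  classical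
  refine ⟨(MulAction.stabilizer (ShearGroup (ZMod p)) (x p)).map
    (MonoidHom.mulSingle (fun p : P ↦ ShearGroup (ZMod p)) p),
    ((ShearGroup.isPGroup p).to_subgroup _).map _, ?_, fun y ↦ ?_⟩
  · rintro _ ⟨g, hg, rfl⟩
    ext1 q
    rw [Pi.smul_apply', MonoidHom.mulSingle_apply]
    by_cases hq : q = p
    · subst hq
      rw [Pi.mulSingle_eq_same]
      exact hg
    · rw [Pi.mulSingle_eq_of_ne hq, one_smul]
  · obtain ⟨g, hgx, hgy⟩ := TwistedSpace.exists_smul_ne hp (x p) (y p)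
    refine ⟨_, ⟨g, hgx, rfl⟩, fun h ↦ hgy ?_⟩
    have := congrFun h p
    rwa [Pi.smul_apply', MonoidHom.mulSingle_apply, Pi.mulSingle_eq_same] at this

theorem not_gSetIsomorphic_twistedProduct (p : P) (hp : t p ≠ t' p) :
    ¬ GSetIsomorphic ((p : P) → ShearGroup (ZMod p)) ((p : P) → TwistedSpace (ZMod p) (t p))
      ((p : P) → TwistedSpace (ZMod p) (t' p)) := by
  rintro ⟨f, hf⟩
  obtain ⟨Q, -, hQx, hQy⟩ := exists_pSubgroup_twistedProduct (t := t) p hp fun _ ↦ default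
  obtain ⟨g, hg, hgy⟩ := hQy (f fun _ ↦ default)
  exact hgy (by rw [← hf, hQx g hg])

theorem not_linearlyEquivalent_twistedProduct {k : Type*} [Field k] (p : P) (hp : t p ≠ t' p)
    (hk : ((p : ℕ) : k) = 0) :
    ¬ LinearlyEquivalent k ((p : P) → ShearGroup (ZMod p))
      ((p : P) → TwistedSpace (ZMod p) (t p)) ((p : P) → TwistedSpace (ZMod p) (t' p)) := by
  intro h
  obtain ⟨Q, hQ, hQx, hQy⟩ := exists_pSubgroup_twistedProduct (t := t) p hp fun _ ↦ default
  obtain ⟨y, hy⟩ := h.exists_fixed_point Fact.out hk Q hQ _ hQx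
  obtain ⟨g, hg, hgy⟩ := hQy y
  exact hgy (hy g hg)

end ShearProduct

/-! ### Sets induced to a wreath product with the group of order two -/

/-- The wreath product of `Γ` with the group of order two: `(l, r, s)` stands for the
pair `(l, r)` times the swap of the two factors, the latter being present when `s` is true. -/
@[ext]
structure WreathTwo (Γ : Type*) where
  /-- The component in the first factor. -/
  left : Γ
  /-- The component in the second factor. -/
  right : Γ
  /-- Whether the factors are swapped. -/
  swap : Bool

namespace WreathTwo

variable {Γ : Type*} [Group Γ]

instance : Mul (WreathTwo Γ) := ⟨fun g h ↦
  ⟨g.left * bif g.swap then h.right else h.left, g.right * bif g.swap then h.left else h.right,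
    xor g.swap h.swap⟩⟩
instance : One (WreathTwo Γ) := ⟨⟨1, 1, false⟩⟩
instance : Inv (WreathTwo Γ) := ⟨fun g ↦
  ⟨bif g.swap then g.right⁻¹ else g.left⁻¹, bif g.swap then g.left⁻¹ else g.right⁻¹, g.swap⟩⟩

theorem mul_def (g h : WreathTwo Γ) : g * h =
  ⟨g.left * bif g.swap then h.right else h.left, g.right * bif g.swap then h.left else h.right,
    xor g.swap h.swap⟩ := rfl
theorem one_def : (1 : WreathTwo Γ) = ⟨1, 1, false⟩ := rfl
theorem inv_def (g : WreathTwo Γ) : g⁻¹ =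
  ⟨bif g.swap then g.right⁻¹ else g.left⁻¹, bif g.swap then g.left⁻¹ else g.right⁻¹, g.swap⟩ := rfl

instance : Group (WreathTwo Γ) := Group.ofLeftAxioms
  (by rintro ⟨a, b, _ | _⟩ ⟨c, d, _ | _⟩ ⟨e, f, _ | _⟩ <;> simp [mul_def, mul_assoc])
  (by rintro ⟨a, b, _ | _⟩ <;> simp [mul_def, one_def])
  (by rintro ⟨a, b, _ | _⟩ <;> simp [mul_def, one_def, inv_def])

instance [Finite Γ] : Finite (WreathTwo Γ) :=
  .of_injective (fun g ↦ (g.left, g.right, g.swap)) fun g h hgh ↦ by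
    simp only [Prod.mk.injEq] at hgh
    exact WreathTwo.ext hgh.1 hgh.2.1 hgh.2.2

end WreathTwo

/-- The `WreathTwo Γ`-set induced from the `Γ × Γ`-set `A × B`. -/
def InducedPair (A B : Type*) : Type _ := (A × B) ⊕ (B × A)

namespace InducedPair

variable {Γ A B A' B' : Type*} [Group Γ] [MulAction Γ A] [MulAction Γ B] [MulAction Γ A']
  [MulAction Γ B']

instance [Fintype A] [Fintype B] : Fintype (InducedPair A B) :=
  inferInstanceAs (Fintype ((A × B) ⊕ (B × A)))
instance [DecidableEq A] [DecidableEq B] : DecidableEq (InducedPair A B) :=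
  inferInstanceAs (DecidableEq ((A × B) ⊕ (B × A)))

/-- Pairs act componentwise, and the swap exchanges the two components and the two summands. -/
def act (g : WreathTwo Γ) : (A × B) ⊕ (B × A) → (A × B) ⊕ (B × A)
  | .inl (a, b) => bif g.swap then .inr (g.left • b, g.right • a) else .inl (g.left • a, g.right • b)
  | .inr (b, a) => bif g.swap then .inl (g.left • a, g.right • b) else .inr (g.left • b, g.right • a)

instance : MulAction (WreathTwo Γ) (InducedPair A B) where
  smul := act
  one_smul := by
    rintro (⟨a, b⟩ | ⟨b, a⟩) <;> change act 1 _ = _ <;> simp [act, WreathTwo.one_def]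
  mul_smul := by
    rintro ⟨l, r, _ | _⟩ ⟨l', r', _ | _⟩ (⟨a, b⟩ | ⟨b, a⟩) <;> change act _ _ = act _ (act _ _) <;>
      simp [act, WreathTwo.mul_def, mul_smul]

theorem isTransitiveGSet (hA : IsTransitiveGSet Γ A) (hB : IsTransitiveGSet Γ B) :
    IsTransitiveGSet (WreathTwo Γ) (InducedPair A B) := by
  obtain ⟨⟨a₀⟩, hA⟩ := hA
  obtain ⟨⟨b₀⟩, hB⟩ := hB
  refine ⟨⟨Sum.inl (a₀, b₀)⟩, (MulAction.isPretransitive_iff_base (X := InducedPair A B)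
    (Sum.inl (a₀, b₀))).mpr ?_⟩
  rintro (⟨a, b⟩ | ⟨b, a⟩) <;> obtain ⟨g, rfl⟩ := hA.exists_smul_eq a₀ a <;>
    obtain ⟨h, rfl⟩ := hB.exists_smul_eq b₀ b
  · exact ⟨⟨g, h, false⟩, rfl⟩
  · exact ⟨⟨h, g, true⟩, rfl⟩

/-- A point of `InducedPair A B` is fixed by the stabilizer of its first component in the first
factor, so an isomorphism would carry a point stabilizer of `A` into one of `A'` or `B'`. -/
theorem not_gSetIsomorphic [Nonempty B] (a : A) (hA' : ∀ a' : A', ∃ g : Γ, g • a = a ∧ g • a' ≠ a')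
    (hB' : ∀ b' : B', ∃ g : Γ, g • a = a ∧ g • b' ≠ b') :
    ¬ GSetIsomorphic (WreathTwo Γ) (InducedPair A B) (InducedPair A' B') := by
  rintro ⟨f, hf⟩
  obtain ⟨b⟩ := ‹Nonempty B›
  have hfix : ∀ g : Γ, g • a = a →
      act ⟨g, 1, false⟩ (f (Sum.inl (a, b))) = f (Sum.inl (a, b)) := fun g hg ↦ by
    refine (hf ⟨g, 1, false⟩ (Sum.inl (a, b))).symm.trans (congrArg f ?_)
    change act _ _ = _
    simp [act, hg]
  rcases hfa : f (Sum.inl (a, b)) with ⟨a', b'⟩ | ⟨b', a'⟩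
  · obtain ⟨g, hga, hga'⟩ := hA' a'
    have := hfix g hga
    rw [hfa] at this
    exact hga' (congrArg Prod.fst (Sum.inl_injective this))
  · obtain ⟨g, hga, hgb'⟩ := hB' b'
    have := hfix g hga
    rw [hfa] at this
    exact hgb' (congrArg Prod.fst (Sum.inr_injective this))

variable {k : Type*} [Field k] [Fintype A] [Fintype B] [Fintype A'] [Fintype B']
  [DecidableEq A] [DecidableEq B] [DecidableEq A'] [DecidableEq B']

open scoped Kronecker in
theorem kernelEquivalent (hA : KernelEquivalent k Γ A A') (hB : KernelEquivalent k Γ B B') :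
    KernelEquivalent k (WreathTwo Γ) (InducedPair A B) (InducedPair A' B') := by
  obtain ⟨M₁, N₁, hMN₁, hNM₁, hM₁⟩ := hA
  obtain ⟨M₂, N₂, hMN₂, hNM₂, hM₂⟩ := hB
  refine ⟨Matrix.fromBlocks (M₁ ⊗ₖ M₂) 0 0 (M₂ ⊗ₖ M₁),
    Matrix.fromBlocks (N₁ ⊗ₖ N₂) 0 0 (N₂ ⊗ₖ N₁), ?_, ?_, ?_⟩
  · refine (Matrix.fromBlocks_multiply ..).trans (Eq.trans ?_ Matrix.fromBlocks_one)
    simp [← Matrix.mul_kronecker_mul, hMN₁, hMN₂]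
  · refine (Matrix.fromBlocks_multiply ..).trans (Eq.trans ?_ Matrix.fromBlocks_one)
    simp [← Matrix.mul_kronecker_mul, hNM₁, hNM₂]
  · rintro ⟨l, r, _ | _⟩ (⟨a', b'⟩ | ⟨b', a'⟩) (⟨a, b⟩ | ⟨b, a⟩) <;>
      change Matrix.fromBlocks _ _ _ _ (act _ _) (act _ _) = _ <;>
      simp [act, Matrix.kroneckerMap_apply, hM₁, hM₂, mul_comm]

open scoped Kronecker in
/-- The roles of the two factors may be exchanged, since the swap identifies `InducedPair A B` with
`InducedPair B A`. -/
theorem kernelEquivalent_swap (hA : KernelEquivalent k Γ A B') (hB : KernelEquivalent k Γ B A') :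
    KernelEquivalent k (WreathTwo Γ) (InducedPair A B) (InducedPair A' B') := by
  obtain ⟨M₁, N₁, hMN₁, hNM₁, hM₁⟩ := hA
  obtain ⟨M₂, N₂, hMN₂, hNM₂, hM₂⟩ := hB
  refine ⟨Matrix.fromBlocks 0 (M₂ ⊗ₖ M₁) (M₁ ⊗ₖ M₂) 0,
    Matrix.fromBlocks 0 (N₁ ⊗ₖ N₂) (N₂ ⊗ₖ N₁) 0, ?_, ?_, ?_⟩
  · refine (Matrix.fromBlocks_multiply ..).trans (Eq.trans ?_ Matrix.fromBlocks_one)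
    simp [← Matrix.mul_kronecker_mul, hMN₁, hMN₂]
  · refine (Matrix.fromBlocks_multiply ..).trans (Eq.trans ?_ Matrix.fromBlocks_one)
    simp [← Matrix.mul_kronecker_mul, hNM₁, hNM₂]
  · rintro ⟨l, r, _ | _⟩ (⟨a', b'⟩ | ⟨b', a'⟩) (⟨a, b⟩ | ⟨b, a⟩) <;>
      change Matrix.fromBlocks _ _ _ _ (act _ _) (act _ _) = _ <;>
      simp [act, Matrix.kroneckerMap_apply, hM₁, hM₂, mul_comm]

end InducedPair

/-! ### The two cases -/

theorem natCast_ne_zero_of_ringChar_notMem {k : Type*} [Field k] {P : Finset ℕ}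
    (hk : ringChar k ∉ P) {p : ℕ} (hp : p.Prime) (hpP : p ∈ P) : (p : k) ≠ 0 := by
  intro h0
  rcases (Nat.dvd_prime hp).mp (ringChar.dvd h0) with h | h
  · exact CharP.ringChar_ne_one h
  · exact hk (h ▸ hpP)

/-- The case of no excluded characteristic. In `InducedPair A B`, both twists are changed at `2`
away from characteristic `2`, and both at `3` otherwise; up to the order of the two factors,
the outcome is the same. -/
theorem exists_linearlyEquivalent_of_every_field :
    ∃ (G : Type) (_ : Group G) (_ : Finite G)
      (X : Type) (_ : Finite X) (_ : MulAction G X)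
      (Y : Type) (_ : Finite Y) (_ : MulAction G Y),
      IsTransitiveGSet G X ∧ IsTransitiveGSet G Y ∧ ¬ GSetIsomorphic G X Y ∧
      ∀ (k : Type*) [Field k], LinearlyEquivalent k G X Y := by
  let P : Finset ℕ := {2, 3}
  have : ∀ p : P, Fact (p : ℕ).Prime := by
    rintro ⟨p, hp⟩
    simp only [P, Finset.mem_insert, Finset.mem_singleton] at hp
    rcases hp with rfl | rfl
    · exact ⟨Nat.prime_two⟩
    · exact ⟨Nat.prime_three⟩
  let two : P := ⟨2, by simp [P]⟩
  let three : P := ⟨3, by simp [P]⟩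
  have hP : ∀ p : P, p = two ∨ p = three := by
    rintro ⟨p, hp⟩
    simpa [P, two, three] using hp
  have h23 : three ≠ two := by simp [two, three]
  let S : ((p : P) → ZMod p) → Type := fun t ↦ (p : P) → TwistedSpace (ZMod p) (t p)
  let t : Bool → Bool → (p : P) → ZMod p := fun i j p ↦
    if p = two then bif i then 1 else 0 else bif j then 1 else 0
  have ht2 : ∀ i j j', t i j two ≠ t (!i) j' two := by
    rintro (_ | _) j j' <;> simp [t]
  have ht3 : ∀ i i' j, t i j three ≠ t i' (!j) three := by
    rintro i i' (_ | _) <;> simp [t, h23]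
  have hmove : ∀ (s s' : (p : P) → ZMod p) (p : P), s p ≠ s' p → ∀ (x : S s) (y : S s'),
      ∃ g : (p : P) → ShearGroup (ZMod p), g • x = x ∧ g • y ≠ y := by
    intro s s' p hp x y
    obtain ⟨Q, -, hQx, hQy⟩ := exists_pSubgroup_twistedProduct p hp x
    obtain ⟨g, hg, hgy⟩ := hQy y
    exact ⟨g, hQx g hg, hgy⟩
  refine ⟨WreathTwo ((p : P) → ShearGroup (ZMod p)), inferInstance, inferInstance,
    InducedPair (S (t false false)) (S (t true true)), inferInstance, inferInstance,
    InducedPair (S (t true false)) (S (t false true)), inferInstance, inferInstance,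
    InducedPair.isTransitiveGSet (isTransitiveGSet_twistedProduct _)
      (isTransitiveGSet_twistedProduct _),
    InducedPair.isTransitiveGSet (isTransitiveGSet_twistedProduct _)
      (isTransitiveGSet_twistedProduct _),
    ?_, fun k _ ↦ KernelEquivalent.linearlyEquivalent ?_⟩
  · have : Nonempty (S (t true true)) := ⟨fun _ ↦ default⟩
    exact InducedPair.not_gSetIsomorphic (fun _ ↦ default)
      (hmove _ _ two (ht2 _ _ _) _) (hmove _ _ three (ht3 _ _ _) _)
  -- Changing the twist at one prime is possible as soon as that prime is invertible in `k`.
  · have hchange2 : ((2 : ℕ) : k) ≠ 0 → ∀ i i' j, KernelEquivalent k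
        ((p : P) → ShearGroup (ZMod p)) (S (t i j)) (S (t i' j)) := by
      refine fun h2 i i' j ↦ kernelEquivalent_twistedProduct fun p hp ↦ ?_
      rcases hP p with rfl | rfl
      · exact h2
      · exact absurd (by simp [t, h23]) hp
    have hchange3 : ((3 : ℕ) : k) ≠ 0 → ∀ i j j', KernelEquivalent k
        ((p : P) → ShearGroup (ZMod p)) (S (t i j)) (S (t i j')) := by
      refine fun h3 i j j' ↦ kernelEquivalent_twistedProduct fun p hp ↦ ?_
      rcases hP p with rfl | rfl
      · exact absurd (by simp [t]) hp
      · exact h3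
    by_cases h2 : ((2 : ℕ) : k) = 0
    · have h3 : ((3 : ℕ) : k) ≠ 0 := by
        rw [show (3 : ℕ) = 2 + 1 from rfl, Nat.cast_add, h2, zero_add, Nat.cast_one]
        exact one_ne_zero
      exact InducedPair.kernelEquivalent_swap (hchange3 h3 _ _ _) (hchange3 h3 _ _ _)
    · exact InducedPair.kernelEquivalent (hchange2 h2 _ _ _) (hchange2 h2 _ _ _)

theorem theorem5p3 (P : Finset ℕ) (hP : ∀ p ∈ P, Nat.Prime p) :
    ∃ (G : Type) (_ : Group G) (_ : Finite G)
      (X : Type) (_ : Finite X) (_ : MulAction G X)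
      (Y : Type) (_ : Finite Y) (_ : MulAction G Y),
      IsTransitiveGSet G X ∧ IsTransitiveGSet G Y ∧
      ¬ GSetIsomorphic G X Y ∧
      (P.Nonempty → IsProductOfPGroups G P) ∧
      ∀ (k : Type*) [Field k], LinearlyEquivalent k G X Y ↔ ringChar k ∉ P := by
  rcases P.eq_empty_or_nonempty with rfl | ⟨p₀, hp₀⟩
  · obtain ⟨G, i₁, i₂, X, i₃, i₄, Y, i₅, i₆, hX, hY, hXY, h⟩ :=
      exists_linearlyEquivalent_of_every_field
    exact ⟨G, i₁, i₂, X, i₃, i₄, Y, i₅, i₆, hX, hY, hXY,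
      fun h ↦ absurd h Finset.not_nonempty_empty,
      fun k _ ↦ ⟨fun _ ↦ Finset.notMem_empty _, fun _ ↦ h k⟩⟩
  · have : ∀ p : P, Fact (p : ℕ).Prime := fun p ↦ ⟨hP p p.2⟩
    have h01 : ∀ p : P, (0 : ZMod p) ≠ 1 := fun p ↦ zero_ne_one
    refine ⟨(p : P) → ShearGroup (ZMod p), inferInstance, inferInstance,
      (p : P) → TwistedSpace (ZMod p) 0, inferInstance, inferInstance,
      (p : P) → TwistedSpace (ZMod p) 1, inferInstance, inferInstance,
      isTransitiveGSet_twistedProduct _, isTransitiveGSet_twistedProduct _,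
      not_gSetIsomorphic_twistedProduct ⟨p₀, hp₀⟩ (h01 _),
      fun _ ↦ ⟨fun p ↦ ShearGroup (ZMod p), inferInstance, fun p ↦ ShearGroup.isPGroup p,
        ⟨MulEquiv.refl _⟩⟩, fun k _ ↦ ⟨fun h hk ↦ ?_, fun hk ↦ ?_⟩⟩
    · exact not_linearlyEquivalent_twistedProduct (⟨ringChar k, hk⟩ : P) (h01 _)
        ringChar.Nat.cast_ringChar h
    · exact (kernelEquivalent_twistedProduct fun p _ ↦
        natCast_ne_zero_of_ringChar_notMem hk (hP p p.2) p.2).linearlyEquivalent
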